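/- For $\omega_1,\omega_2\in\mathbb{C}$ with $\omega_2\neq 0$ and $\tau=\omega_1/\omega_2\in\mathbb{H}=\{\tau\in\mathbb{C}:\operatorname{Im}\tau>0\}$, let $\Gamma=\mathbb{Z}\omega_1+\mathbb{Z}\omega_2$, let $$\zeta(u)=\frac1u+\sum_{\gamma\in\Gamma\setminus\{0\}}\Bigl(\frac1{u-\gamma}+\frac1\gamma+\frac u{\gamma^2}\Bigr)$$ be the Weierstrass zeta function of $\Gamma$, and let $\eta_k=2\zeta(\omega_k/2)$, $k=1,2$, be its quasi-periods, so that $\zeta(u+\omega_k)=\zeta(u)+\eta_k$ for $u\notin\Gamma$. The ratio $\eta_1/\eta_2\in\widehat{\mathbb{C}}=\mathbb{C}\cup\{\infty\}$ depends only on $\tau$; denote it by $p(\tau)$. Let $\rho=\tfrac12(1+i\sqrt3)$. Then $p$ is meromorphic on $\mathbb{H}$, i.e. a holomorphic map $p\colon\mathbb{H}\to\widehat{\mathbb{C}}$ into the Riemann sphere. Its critical points (the points where its derivative in local coordinates vanishes; at a pole of $p$ the coordinate $w\mapsto 1/w$ is used on the target) are precisely the points of $\mathbb{H}$ that are equivalent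 to $\rho$ under the action $\tau\mapsto\frac{a\tau+b}{c\tau+d}$ ($a,b,c,d\in\mathbb{Z}$, $ad-bc=1$) of $\operatorname{PSL}_2(\mathbb{Z})$. Moreover, every critical point of $p$ is of first order, that is, the local degree of $p$ there is $2$. -/

import Mathlib

open scoped Topology UpperHalfPlane MatrixGroups

noncomputable section

namespace PeriodPair

/-- The Weierstrass zeta function of the lattice `Γ` spanned by a pair of periods:
`ζ(u) = 1/u + ∑_{γ ∈ Γ, γ ≠ 0} (1/(u - γ) + 1/γ + u/γ²)`. -/
def weierstrassZeta (L : PeriodPair) (u : ℂ) : ℂ :=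
  1 / u + ∑' l : {l : L.lattice // l ≠ 0},
    (1 / (u - (l : ℂ)) + 1 / (l : ℂ) + u / (l : ℂ) ^ 2)

/-- The quasi-period `η₁` of `ζ` belonging to the period `ω₁`, namely `2 ζ(ω₁/2)`. It is the
constant with `ζ(u + ω₁) = ζ(u) + η₁`, see `weierstrassZeta_add_ω₁`. -/
def eta₁ (L : PeriodPair) : ℂ := 2 * L.weierstrassZeta (L.ω₁ / 2)

/-- The quasi-period `η₂` of `ζ` belonging to the period `ω₂`, namely `2 ζ(ω₂/2)`. It is the
constant with `ζ(u + ω₂) = ζ(u) + η₂`, see `weierstrassZeta_add_ω₂`. -/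
def eta₂ (L : PeriodPair) : ℂ := 2 * L.weierstrassZeta (L.ω₂ / 2)

/-! The series converges locally uniformly (and absolutely) off the lattice, and the quasi-periods
have their defining property. -/

lemma zeta_bound (r : ℝ) (hr : 0 < r) (s : ℂ) (hs : ‖s‖ < r) (l : ℂ) (h : 2 * r ≤ ‖l‖) :
    ‖1 / (s - l) + 1 / l + s / l ^ 2‖ ≤ 2 * r ^ 2 * ‖l‖ ^ (-3 : ℝ) := by
  have h1 : s ≠ l := by rintro rfl; linarith
  have h0 : 0 < ‖l‖ := by linarith
  have hl : l ≠ 0 := norm_pos_iff.mp h0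
  have h2 : s - l ≠ 0 := sub_ne_zero.mpr h1
  have h3 : ‖l‖ / 2 ≤ ‖s - l‖ := by
    rw [norm_sub_rev]
    exact .trans (by linarith) (norm_sub_norm_le l s)
  have e : 1 / (s - l) + 1 / l + s / l ^ 2 = s ^ 2 / (l ^ 2 * (s - l)) := by
    field_simp
    ring
  rw [e, norm_div, norm_mul, norm_pow, norm_pow]
  calc ‖s‖ ^ 2 / (‖l‖ ^ 2 * ‖s - l‖) ≤ r ^ 2 / (‖l‖ ^ 2 * (‖l‖ / 2)) := by gcongr
    _ = 2 * r ^ 2 / ‖l‖ ^ 3 := by field_simp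
    _ = _ := by
      rw [show (-3 : ℝ) = -((3 : ℕ) : ℝ) by norm_num, Real.rpow_neg h0.le, Real.rpow_natCast]
      rfl

lemma hasSumLocallyUniformly_zetaTerms (L : PeriodPair) :
    HasSumLocallyUniformly
      (fun (l : L.lattice) (z : ℂ) ↦ 1 / (z - l) + 1 / (l : ℂ) + z / (l : ℂ) ^ 2)
      (fun z ↦ ∑' l : L.lattice, (1 / (z - l) + 1 / (l : ℂ) + z / (l : ℂ) ^ 2)) := by
  refine L.hasSumLocallyUniformly_aux (u := (2 * · ^ 2 * ‖·‖ ^ (-3 : ℝ))) _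
    (fun _ _ ↦ (ZLattice.summable_norm_rpow _ _ (by simp; norm_num)).mul_left _) fun r hr ↦
    Filter.eventually_atTop.mpr ⟨2 * r, ?_⟩
  rintro _ h s hs l rfl
  exact zeta_bound r hr s hs l h

lemma weierstrassZeta_eq_tsum (L : PeriodPair) (z : ℂ) :
    L.weierstrassZeta z = ∑' l : L.lattice, (1 / (z - l) + 1 / (l : ℂ) + z / (l : ℂ) ^ 2) := by
  classical
  have hs : Summable fun l : L.lattice ↦ (1 / (z - l) + 1 / (l : ℂ) + z / (l : ℂ) ^ 2) :=
    (L.hasSumLocallyUniformly_zetaTerms.hasSum (x := z)).summable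
  rw [hs.tsum_eq_add_tsum_ite (0 : L.lattice), weierstrassZeta]
  congr 1
  · simp
  · rw [← tsum_subtype_eq_of_support_subset (s := {l : L.lattice | l ≠ 0})]
    · refine tsum_congr fun l ↦ ?_
      have : (l : L.lattice) ≠ 0 := l.2
      simp [this]
    · intro l hl
      by_contra h
      simp_all

lemma hasDerivAt_weierstrassZeta (L : PeriodPair) {z : ℂ} (hz : z ∉ L.lattice) :
    HasDerivAt L.weierstrassZeta (-L.weierstrassP z) z := by
  have hopen : IsOpen ((L.lattice : Set ℂ)ᶜ) := L.isClosed_lattice.isOpen_compl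
  have hterm (l : L.lattice) {y : ℂ} (hy : y ∉ L.lattice) :
      HasDerivAt (fun z : ℂ ↦ 1 / (z - l) + 1 / (l : ℂ) + z / (l : ℂ) ^ 2)
        (-(1 / (y - l) ^ 2 - 1 / (l : ℂ) ^ 2)) y := by
    have h0 : y - l ≠ 0 := by
      intro h
      exact hy (by rw [sub_eq_zero.mp h]; exact l.2)
    have h1 := ((hasDerivAt_id y).sub_const (l : ℂ)).fun_inv h0
    have h2 := (h1.add_const (1 / (l : ℂ))).add ((hasDerivAt_id y).div_const ((l : ℂ) ^ 2))
    convert! h2 using 1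
    · ext w; simp
    · simp only [id]; ring
  have hF := L.hasSumLocallyUniformly_zetaTerms
  rw [hasSumLocallyUniformly_iff_tendstoLocallyUniformly] at hF
  have hP := L.hasSumLocallyUniformly_weierstrassP
  rw [hasSumLocallyUniformly_iff_tendstoLocallyUniformly] at hP
  have hsum (s : Finset L.lattice) {y : ℂ} (hy : y ∉ L.lattice) :=
    HasDerivAt.fun_sum (u := s) fun l _ ↦ hterm l hy
  have key := hasDerivAt_of_tendstoLocallyUniformlyOn (l := Filter.atTop) hopen
    (f' := fun (s : Finset L.lattice) y ↦ ∑ l ∈ s, (-(1 / (y - l) ^ 2 - 1 / (l : ℂ) ^ 2)))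
    (g' := fun y ↦ -L.weierstrassP y)
    (f := fun (s : Finset L.lattice) y ↦ ∑ l ∈ s, (1 / (y - l) + 1 / (l : ℂ) + y / (l : ℂ) ^ 2))
    (g := L.weierstrassZeta) (x := z) ?_ ?_ ?_ hz
  · exact key
  · simp only [Finset.sum_neg_distrib]
    exact hP.tendstoLocallyUniformlyOn.neg
  · exact .of_forall fun s y hy ↦ hsum s hy
  · intro y _
    rw [L.weierstrassZeta_eq_tsum]
    exact L.hasSumLocallyUniformly_zetaTerms.hasSum

lemma weierstrassZeta_neg (L : PeriodPair) (z : ℂ) :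
    L.weierstrassZeta (-z) = -L.weierstrassZeta z := by
  rw [weierstrassZeta_eq_tsum, weierstrassZeta_eq_tsum, ← (Equiv.neg L.lattice).tsum_eq,
    ← tsum_neg]
  refine tsum_congr fun l ↦ ?_
  have e : -z - -(l : ℂ) = -(z - l) := by ring
  simp only [Equiv.neg_apply, NegMemClass.coe_neg, e, one_div, inv_neg, even_two, Even.neg_pow]
  ring

lemma weierstrassZeta_add_period (L : PeriodPair) {w : ℂ} (hw : w ∈ L.lattice)
    (hw2 : w / 2 ∉ L.lattice) {u : ℂ} (hu : u ∉ L.lattice) :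
    L.weierstrassZeta (u + w) = L.weierstrassZeta u + 2 * L.weierstrassZeta (w / 2) := by
  have hopen : IsOpen ((L.lattice : Set ℂ)ᶜ) := L.isClosed_lattice.isOpen_compl
  have hcount : (L.lattice : Set ℂ).Countable := by
    have : Countable L.lattice := L.latticeEquivProd.toEquiv.injective.countable
    exact Set.to_countable _
  have hconn : IsPreconnected ((L.lattice : Set ℂ)ᶜ) :=
    (hcount.isConnected_compl_of_one_lt_rank (by simp [Complex.rank_real_complex])).isPreconnected
  have hadd {y : ℂ} (hy : y ∉ L.lattice) : y + w ∉ L.lattice := fun h ↦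
    hy (by simpa using sub_mem h hw)
  have hD {y : ℂ} (hy : y ∉ L.lattice) :
      HasDerivAt (fun z ↦ L.weierstrassZeta (z + w) - L.weierstrassZeta z) 0 y := by
    have h1 := (L.hasDerivAt_weierstrassZeta (hadd hy)).comp_add_const y w
    have h2 := h1.sub (L.hasDerivAt_weierstrassZeta hy)
    have h3 : L.weierstrassP (y + w) = L.weierstrassP y := L.weierstrassP_add_coe y ⟨w, hw⟩
    rw [h3, sub_self] at h2
    exact h2
  have hneg : -(w / 2) ∉ L.lattice := fun h ↦ hw2 (by simpa using neg_mem h)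
  have := hopen.is_const_of_deriv_eq_zero (𝕜 := ℂ) hconn
    (fun y hy ↦ (hD hy).differentiableAt.differentiableWithinAt) (fun y hy ↦ (hD hy).deriv)
    (x := u) (y := -(w / 2)) hu hneg
  simp only [weierstrassZeta_neg, show -(w / 2) + w = w / 2 by ring] at this
  linear_combination this

/-- `ζ(u + ω₁) = ζ(u) + η₁`. -/
theorem weierstrassZeta_add_ω₁ (L : PeriodPair) {u : ℂ} (hu : u ∉ L.lattice) :
    L.weierstrassZeta (u + L.ω₁) = L.weierstrassZeta u + L.eta₁ :=
  L.weierstrassZeta_add_period L.ω₁_mem_lattice L.ω₁_div_two_notMem_lattice hu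

/-- `ζ(u + ω₂) = ζ(u) + η₂`. -/
theorem weierstrassZeta_add_ω₂ (L : PeriodPair) {u : ℂ} (hu : u ∉ L.lattice) :
    L.weierstrassZeta (u + L.ω₂) = L.weierstrassZeta u + L.eta₂ :=
  L.weierstrassZeta_add_period L.ω₂_mem_lattice L.ω₂_div_two_notMem_lattice hu

open Classical in
/-- The ratio `η₁/η₂` of the quasi-periods, a point of the Riemann sphere `ℂ ∪ {∞}`
(the quasi-periods never vanish simultaneously). -/
def quasiPeriodRatio (L : PeriodPair) : OnePoint ℂ :=
  if L.eta₂ = 0 then OnePoint.infty else ((L.eta₁ / L.eta₂ : ℂ) : OnePoint ℂ)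

/-- The pair of periods `(τ, 1)`, for `τ` in the upper half-plane. -/
def ofUpperHalfPlane (τ : ℍ) : PeriodPair where
  ω₁ := τ
  ω₂ := 1
  indep := by
    rw [LinearIndependent.pair_iff]
    intro s t h
    have him := congrArg Complex.im h
    have hre := congrArg Complex.re h
    have hs : s = 0 := by
      simpa [τ.im_pos.ne'] using him
    refine ⟨hs, ?_⟩
    simpa [hs] using hre

end PeriodPair

/-- The function `p = η₁/η₂` of `τ = ω₁/ω₂ ∈ ℍ`, with values in the Riemann sphere. The ratio
`η₁/η₂` is unchanged when both periods are multiplied by the same nonzero number, so that it is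
evaluated at the periods `(τ, 1)`. See `PeriodPair.quasiPeriodRatio_eq`. -/
def quasiPeriodMap (τ : ℍ) : OnePoint ℂ := (PeriodPair.ofUpperHalfPlane τ).quasiPeriodRatio

/-- Homogeneity: for all periods with `ω₁/ω₂ = τ ∈ ℍ`, the ratio `η₁/η₂` is `p(τ)`. -/
theorem PeriodPair.quasiPeriodRatio_eq (L : PeriodPair) (τ : ℍ) (h : L.ω₁ / L.ω₂ = τ) :
    L.quasiPeriodRatio = quasiPeriodMap τ := by
  have hw : L.ω₂ ≠ 0 := by
    intro h0
    rw [h0, div_zero] at h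
    exact τ.ne_zero h.symm
  have h1 : L.ω₁ = L.ω₂ * τ := by rw [← h]; field_simp
  set M := PeriodPair.ofUpperHalfPlane τ with hM
  have hM1 : M.ω₁ = τ := rfl
  have hM2 : M.ω₂ = 1 := rfl
  have hmem (x : ℂ) : x ∈ M.lattice ↔ L.ω₂ * x ∈ L.lattice := by
    simp only [PeriodPair.mem_lattice, hM1, hM2, h1]
    refine exists_congr fun m ↦ exists_congr fun n ↦ ⟨fun e ↦ by rw [← e]; ring, fun e ↦ ?_⟩
    apply mul_left_cancel₀ hw
    rw [← e]; ring
  let e : M.lattice ≃ L.lattice :=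
    { toFun := fun x ↦ ⟨L.ω₂ * x, (hmem x).1 x.2⟩
      invFun := fun y ↦ ⟨y / L.ω₂, (hmem _).2 (by rw [mul_div_cancel₀ _ hw]; exact y.2)⟩
      left_inv := fun x ↦ by ext; simp [hw]
      right_inv := fun y ↦ by ext; simp [mul_div_cancel₀ _ hw] }
  have hz (z : ℂ) : L.weierstrassZeta (L.ω₂ * z) = L.ω₂⁻¹ * M.weierstrassZeta z := by
    rw [L.weierstrassZeta_eq_tsum, M.weierstrassZeta_eq_tsum, ← e.tsum_eq, ← tsum_mul_left]
    refine tsum_congr fun l ↦ ?_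
    change 1 / (L.ω₂ * z - L.ω₂ * l) + 1 / (L.ω₂ * l) + L.ω₂ * z / (L.ω₂ * l) ^ 2 = _
    rw [← mul_sub, mul_pow]
    field_simp
  have he1 : L.eta₁ = L.ω₂⁻¹ * M.eta₁ := by
    simp only [PeriodPair.eta₁, hM1, h1, mul_div_assoc, hz]; ring
  have he2 : L.eta₂ = L.ω₂⁻¹ * M.eta₂ := by
    have := hz (1 / 2)
    simp only [PeriodPair.eta₂, hM2, mul_one_div] at this ⊢
    rw [this]; ring
  simp only [quasiPeriodMap, ← hM, PeriodPair.quasiPeriodRatio, he1, he2, mul_eq_zero, inv_eq_zero,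
    hw, false_or, mul_div_mul_left _ _ (inv_ne_zero hw)]

namespace RiemannSphere

/-- The affine coordinate `w ↦ w` of the Riemann sphere, a chart on the complement of `∞`
(the value at `∞` is immaterial). -/
def affineCoord (w : OnePoint ℂ) : ℂ := w.elim 0 id

/-- The coordinate `w ↦ 1/w`, `∞ ↦ 0` of the Riemann sphere, a chart on the complement of `0`
(the value at `0` is immaterial). -/
def infinityCoord (w : OnePoint ℂ) : ℂ := w.elim 0 fun z ↦ z⁻¹

open Classical in
/-- The standard chart of the Riemann sphere centred around `w₀`: the affine coordinate if `w₀` is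
finite, and `w ↦ 1/w` if `w₀ = ∞`. -/
def coordAt (w₀ : OnePoint ℂ) : OnePoint ℂ → ℂ :=
  if w₀ = OnePoint.infty then infinityCoord else affineCoord

/-- The local expression, near `τ`, of a map `f` from the upper half-plane to the Riemann sphere, in
the coordinate at `f τ`. -/
def localRep (f : ℍ → OnePoint ℂ) (τ : ℍ) : ℂ → ℂ :=
  fun z ↦ coordAt (f τ) (f (UpperHalfPlane.ofComplex z))

/-- `f` is holomorphic near `τ` as a map into the Riemann sphere, that is, it is meromorphic as a
function. -/
def HolomorphicAt (f : ℍ → OnePoint ℂ) (τ : ℍ) : Prop :=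
  ContinuousAt f τ ∧ AnalyticAt ℂ (localRep f τ) τ

/-- `τ` is a critical point of `f`: `f` is holomorphic near `τ` as a map into the Riemann sphere,
and its derivative at `τ` in local coordinates vanishes. -/
def IsCriticalPoint (f : ℍ → OnePoint ℂ) (τ : ℍ) : Prop :=
  HolomorphicAt f τ ∧ deriv (localRep f τ) τ = 0

/-- The local degree of `f` at `τ`: the order to which `f` takes the value `f τ` at `τ`, in local
coordinates. A critical point is of first order when the local degree there is `2`. -/
def localDegree (f : ℍ → OnePoint ℂ) (τ : ℍ) : ℕ∞ :=
  analyticOrderAt (fun z ↦ localRep f τ z - localRep f τ τ) τ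

end RiemannSphere

/-- The point `ρ = (1 + i√3)/2` of the upper half-plane. -/
def rhoPoint : ℍ := ⟨⟨1 / 2, Real.sqrt 3 / 2⟩, by positivity⟩

end

namespace PeriodPair

lemma ofUpperHalfPlane_latticeEquivProd_symm (τ : ℍ) (x : ℤ × ℤ) :
    (((ofUpperHalfPlane τ).latticeEquivProd.symm x : (ofUpperHalfPlane τ).lattice) : ℂ) =
      x.1 * τ + x.2 := by
  rw [latticeEquiv_symm_apply]
  simp [ofUpperHalfPlane]

lemma hasSum_weierstrassZeta (L : PeriodPair) (z : ℂ) :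
    HasSum (fun l : L.lattice ↦ (1 / (z - l) + 1 / (l : ℂ) + z / (l : ℂ) ^ 2))
      (L.weierstrassZeta z) := by
  rw [weierstrassZeta_eq_tsum]
  exact L.hasSumLocallyUniformly_zetaTerms.hasSum

lemma hasSum_eta₂ (τ : ℍ) :
    HasSum (fun x : ℤ × ℤ ↦ (1 / ((x.1 * τ + x.2 : ℂ) + 1 / 2) - 1 / ((x.1 * τ + x.2 : ℂ) - 1 / 2))
      + 1 / (x.1 * τ + x.2 : ℂ) ^ 2) (ofUpperHalfPlane τ).eta₂ := by
  have h := ((ofUpperHalfPlane τ).hasSum_weierstrassZeta (1 / 2)).sub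
    ((ofUpperHalfPlane τ).hasSum_weierstrassZeta (-(1 / 2)))
  rw [weierstrassZeta_neg, sub_neg_eq_add, ← two_mul] at h
  rw [← (ofUpperHalfPlane τ).latticeEquivProd.symm.toEquiv.hasSum_iff] at h
  convert! h using 1
  ext x
  simp only [Function.comp_apply, LinearEquiv.coe_toEquiv,
    ofUpperHalfPlane_latticeEquivProd_symm]
  generalize (x.1 * τ + x.2 : ℂ) = l
  rw [← neg_add' (1 / 2 : ℂ) l, ← neg_sub l (1 / 2 : ℂ), one_div_neg_eq_neg_one_div,
    one_div_neg_eq_neg_one_div]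
  ring

end PeriodPair

lemma tsum_int_telescope {f : ℤ → ℂ} (hf : Summable fun n ↦ f n - f (n + 1))
    (h : Filter.Tendsto f Filter.cofinite (𝓝 0)) : ∑' n, (f n - f (n + 1)) = 0 := by
  rw [Int.cofinite_eq, Filter.tendsto_sup] at h
  have key : HasSum (fun n ↦ f n - f (n + 1)) 0 (SummationFilter.symmetricIco ℤ) := by
    rw [SummationFilter.hasSum_symmetricIco_int_iff]
    simp_rw [Finset.sum_Ico_int_sub]
    simpa using (h.1.comp (Filter.tendsto_neg_atTop_atBot.comp tendsto_natCast_atTop_atTop)).sub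
      (h.2.comp tendsto_natCast_atTop_atTop)
  rw [← tsum_eq_of_summable_unconditional (L := SummationFilter.symmetricIco ℤ) hf, key.tsum_eq]

lemma tendsto_one_div_add_intCast (c : ℂ) :
    Filter.Tendsto (fun n : ℤ ↦ 1 / (c + n)) Filter.cofinite (𝓝 0) := by
  simp_rw [one_div]
  refine Filter.tendsto_inv₀_cobounded.comp ?_
  have : Filter.Tendsto (fun n : ℤ ↦ (n : ℂ)) Filter.cofinite (Bornology.cobounded ℂ) := by
    rw [← tendsto_norm_atTop_iff_cobounded]
    have := tendsto_norm_cocompact_atTop (E := ℤ)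
    simpa [← Int.norm_eq_abs] using this
  exact (tendsto_const_add_cobounded c).comp this

namespace PeriodPair

theorem eta₂_ofUpperHalfPlane (τ : ℍ) : (ofUpperHalfPlane τ).eta₂ = EisensteinSeries.G2 τ := by
  have h := hasSum_eta₂ τ
  have hfib (m : ℤ) : ∑' n : ℤ, ((1 / ((m * τ + n : ℂ) + 1 / 2) - 1 / ((m * τ + n : ℂ) - 1 / 2))
      + 1 / (m * τ + n : ℂ) ^ 2) = EisensteinSeries.e2Summand m τ := by
    have h1 : Summable fun n : ℤ ↦ ((1 / ((m * τ + n : ℂ) + 1 / 2) -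
      1 / ((m * τ + n : ℂ) - 1 / 2)) + 1 / (m * τ + n : ℂ) ^ 2) := h.summable.prod_factor m
    have e2 (n : ℤ) : 1 / (m * τ + n : ℂ) ^ 2 = EisensteinSeries.eisSummand 2 ![m, n] τ := by
      simp [EisensteinSeries.eisSummand]
    have h2 : Summable fun n : ℤ ↦ 1 / (m * τ + n : ℂ) ^ 2 := by
      simp_rw [e2]
      exact EisensteinSeries.e2Summand_summable m τ
    have h3 : Summable fun n : ℤ ↦ 1 / ((m * τ + n : ℂ) + 1 / 2) - 1 / ((m * τ + n : ℂ) - 1 / 2) :=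
      by simpa using h1.sub h2
    rw [h3.tsum_add h2]
    simp_rw [e2]
    rw [EisensteinSeries.e2Summand, add_eq_right]
    set f : ℤ → ℂ := fun n ↦ -(1 / ((m * τ - 1 / 2 : ℂ) + n)) with hf
    have e3 (n : ℤ) : 1 / ((m * τ + n : ℂ) + 1 / 2) - 1 / ((m * τ + n : ℂ) - 1 / 2) =
        f n - f (n + 1) := by
      simp only [hf]
      push_cast
      ring
    have ht : Filter.Tendsto f Filter.cofinite (𝓝 0) := by
      rw [← neg_zero]
      exact (tendsto_one_div_add_intCast (m * τ - 1 / 2 : ℂ)).neg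
    simp only [e3] at h3 ⊢
    exact tsum_int_telescope h3 ht
  have h' := h.prod_fiberwise fun m ↦ (h.summable.prod_factor m).hasSum
  simp only [hfib] at h'
  rw [EisensteinSeries.G2, tsum_eq_of_summable_unconditional h'.summable, h'.tsum_eq]

lemma weierstrassZeta_ofUpperHalfPlane_S_smul (τ : ℍ) (z : ℂ) :
    (ofUpperHalfPlane (ModularGroup.S • τ)).weierstrassZeta z =
      τ * (ofUpperHalfPlane τ).weierstrassZeta (τ * z) := by
  set M := ofUpperHalfPlane (ModularGroup.S • τ) with hM
  set L := ofUpperHalfPlane τ with hL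
  have hτ := τ.ne_zero
  have hM1 : M.ω₁ = -(τ : ℂ)⁻¹ := by
    change ((ModularGroup.S • τ : ℍ) : ℂ) = _
    rw [UpperHalfPlane.modular_S_smul]
    exact inv_neg
  have hmem (x : ℂ) : x ∈ M.lattice ↔ τ * x ∈ L.lattice := by
    simp only [mem_lattice, hM1, show M.ω₂ = 1 from rfl, show L.ω₁ = τ from rfl,
      show L.ω₂ = 1 from rfl]
    constructor
    · rintro ⟨m, n, rfl⟩
      exact ⟨n, -m, by push_cast; field_simp; ring⟩
    · rintro ⟨m, n, e⟩
      refine ⟨-n, m, mul_left_cancel₀ hτ ?_⟩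
      rw [← e]; push_cast; field_simp; ring
  let e : M.lattice ≃ L.lattice :=
    { toFun := fun x ↦ ⟨τ * x, (hmem x).1 x.2⟩
      invFun := fun y ↦ ⟨y / τ, (hmem _).2 (by rw [mul_div_cancel₀ _ hτ]; exact y.2)⟩
      left_inv := fun x ↦ by ext; simp [hτ]
      right_inv := fun y ↦ by ext; simp [mul_div_cancel₀ _ hτ] }
  rw [L.weierstrassZeta_eq_tsum, M.weierstrassZeta_eq_tsum, ← e.tsum_eq, ← tsum_mul_left]
  refine tsum_congr fun l ↦ ?_
  change _ = (τ : ℂ) * (1 / (τ * z - τ * l) + 1 / (τ * l) + τ * z / (τ * l) ^ 2)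
  rw [← mul_sub, mul_pow]
  field_simp

/-- Legendre's relation for the periods `(τ, 1)`. -/
theorem eta₁_ofUpperHalfPlane (τ : ℍ) :
    (ofUpperHalfPlane τ).eta₁ = τ * EisensteinSeries.G2 τ - 2 * Real.pi * Complex.I := by
  have hτ := τ.ne_zero
  have h := eta₂_ofUpperHalfPlane (ModularGroup.S • τ)
  rw [eta₂, weierstrassZeta_ofUpperHalfPlane_S_smul] at h
  rw [EisensteinSeries.G2_S_transform, ← h, eta₁]
  change 2 * weierstrassZeta _ ((τ : ℂ) / 2) = _
  change _ = τ * ((τ ^ 2 : ℂ)⁻¹ * (2 * (τ * weierstrassZeta _ (τ * (1 / 2)))) - _) - _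
  rw [mul_one_div]
  field_simp
  ring

end PeriodPair

lemma quasiPeriodMap_eq_infty {τ : ℍ} (h : EisensteinSeries.G2 τ = 0) :
    quasiPeriodMap τ = OnePoint.infty := by
  rw [quasiPeriodMap, PeriodPair.quasiPeriodRatio, PeriodPair.eta₂_ofUpperHalfPlane, if_pos h]

lemma quasiPeriodMap_eq_coe {τ : ℍ} (h : EisensteinSeries.G2 τ ≠ 0) :
    quasiPeriodMap τ =
      ((τ - 2 * Real.pi * Complex.I / EisensteinSeries.G2 τ : ℂ) : OnePoint ℂ) := by
  rw [quasiPeriodMap, PeriodPair.quasiPeriodRatio, PeriodPair.eta₂_ofUpperHalfPlane, if_neg h,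
    PeriodPair.eta₁_ofUpperHalfPlane, sub_div, mul_div_cancel_right₀ _ h]

section LevelOneLimits

open UpperHalfPlane ModularForm EisensteinSeries Derivative Filter
open scoped Manifold

lemma tendsto_atImInfty_of_hasSum_qParam {f : ℍ → ℂ} {c : ℕ → ℂ}
    (hf : ∀ τ : ℍ, HasSum (fun m ↦ c m * Function.Periodic.qParam 1 τ ^ m) (f τ)) :
    Tendsto f atImInfty (𝓝 (c 0)) := by
  have e : f = fun τ : ℍ ↦ ∑' m, c m * Function.Periodic.qParam 1 τ ^ m :=
    funext fun τ ↦ (hf τ).tsum_eq.symm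
  have h0 : c 0 = ∑' m, if m = 0 then c 0 else 0 := by simp
  rw [e, h0]
  have hq := qParam_tendsto_atImInfty (one_pos : (0 : ℝ) < 1)
  refine tendsto_tsum_of_dominated_convergence (hf I).summable.norm (fun m ↦ ?_) ?_
  · rcases eq_or_ne m 0 with rfl | hm
    · simp
    · simpa [hm] using (hq.pow m).const_mul (c m)
  · have hI : 0 < ‖Function.Periodic.qParam 1 (I : ℍ)‖ :=
      norm_pos_iff.mpr (Function.Periodic.qParam_ne_zero _)
    filter_upwards [hq.norm.eventually_le_const (u := ‖Function.Periodic.qParam 1 (I : ℍ)‖)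
      (by simpa using hI)] with τ hτ m
    rw [norm_mul, norm_mul, norm_pow, norm_pow]
    gcongr

lemma tendsto_E2_atImInfty : Tendsto E2 atImInfty (𝓝 1) := by
  simpa using tendsto_atImInfty_of_hasSum_qParam
    (c := fun m ↦ if m = 0 then 1 else -24 * (ArithmeticFunction.sigma 1 m : ℂ)) fun τ ↦ by
      simpa [Function.Periodic.qParam] using hasSum_qExpansion_E2 (z := τ)

lemma hasSum_qParam_levelOne {k : ℤ} (f : ModularForm 𝒮ℒ k) (τ : ℍ) :
    HasSum (fun m ↦ (qExpansion 1 f).coeff m * Function.Periodic.qParam 1 τ ^ m) (f τ) :=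
  ModularForm.hasSum_qExpansion (Γ := 𝒮ℒ) f one_pos one_mem_strictPeriods_SL τ

lemma tendsto_E_atImInfty {k : ℕ} (hk : 3 ≤ k) (hk2 : Even k) :
    Tendsto (E hk) atImInfty (𝓝 1) := by
  rw [← E_qExpansion_coeff_zero hk hk2]
  exact tendsto_atImInfty_of_hasSum_qParam (hasSum_qParam_levelOne (E hk))

/-- The derivative of a holomorphic function that is bounded at `i∞` tends to `0` there. -/
lemma tendsto_normalizedDerivOfComplex_atImInfty {F : ℍ → ℂ} (hF : MDiff F)
    (hb : IsBoundedAtImInfty F) : Tendsto (D F) atImInfty (𝓝 0) := by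
  obtain ⟨M, A, hM⟩ := isBoundedAtImInfty_iff.mp hb
  rw [UpperHalfPlane.mdifferentiable_iff] at hF
  have him : Tendsto UpperHalfPlane.im atImInfty atTop := tendsto_comap
  have hderiv : Tendsto (fun τ : ℍ ↦ deriv (F ∘ ofComplex) τ) atImInfty (𝓝 0) := by
    have hlim : Tendsto (fun τ : ℍ ↦ M / (τ.im - max A 0 - 1)) atImInfty (𝓝 0) :=
      (tendsto_atTop_add_const_right _ _ (tendsto_atTop_add_const_right _ _ him)).const_div_atTop _
    refine squeeze_zero_norm' ?_ hlim
    filter_upwards [him.eventually_gt_atTop (max A 0 + 1)] with τ hτ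
    have him' {w : ℂ} (hw : w ∈ Metric.closedBall (τ : ℂ) (τ.im - max A 0 - 1)) :
        max A 0 + 1 ≤ w.im := by
      have h1 := (Complex.abs_im_le_norm (w - τ)).trans (mem_closedBall_iff_norm.mp hw)
      rw [Complex.sub_im, UpperHalfPlane.coe_im] at h1
      linarith [neg_abs_le (w.im - τ.im)]
    have hpos {w : ℂ} (hw : w ∈ Metric.closedBall (τ : ℂ) (τ.im - max A 0 - 1)) : 0 < w.im := by
      linarith [him' hw, le_max_right A 0]
    refine Complex.norm_deriv_le_of_forall_mem_sphere_norm_le (by linarith) ?_ fun w hw ↦ ?_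
    · refine DifferentiableOn.diffContOnCl (hF.mono fun w hw ↦ ?_)
      exact hpos (Metric.closure_ball_subset_closedBall hw)
    · have hw' := Metric.sphere_subset_closedBall hw
      rw [Function.comp_apply, ofComplex_apply_of_im_pos (hpos hw')]
      exact hM _ (by
        change A ≤ w.im
        linarith [him' hw', le_max_left A 0])
  rw [← mul_zero (2 * Real.pi * Complex.I)⁻¹]
  exact hderiv.const_mul (2 * Real.pi * Complex.I)⁻¹

/-- A level one modular form from a holomorphic invariant function with a limit at `i∞`. -/
lemma exists_modularForm_levelOne {F : ℍ → ℂ} {k : ℤ} {c : ℂ} (hF : MDiff F)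
    (hinv : ∀ γ : SL(2, ℤ), F ∣[k] γ = F) (hlim : Tendsto F atImInfty (𝓝 c)) :
    ∃ f : ModularForm 𝒮ℒ k, ⇑f = F :=
  ⟨{ toFun := F
     slash_action_eq' := fun _ ⟨γ, hγ⟩ ↦ hγ ▸ hinv γ
     holo' := hF
     bdd_at_cusps' := fun {d} hd ↦ by
      rw [Subgroup.IsArithmetic.isCusp_iff_isCusp_SL2Z] at hd
      rw [OnePoint.isBoundedAt_iff_forall_SL2Z hd]
      intro γ _
      rw [hinv γ]
      exact hlim.isBigO_one ℝ }, rfl⟩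

lemma eq_smul_E_of_rank_one {k : ℕ} (hk : 3 ≤ k) (hk2 : Even k)
    (hrank : Module.rank ℂ (ModularForm 𝒮ℒ k) = 1) {F : ℍ → ℂ} {c : ℂ} (hF : MDiff F)
    (hinv : ∀ γ : SL(2, ℤ), F ∣[(k : ℤ)] γ = F) (hlim : Tendsto F atImInfty (𝓝 c)) (τ : ℍ) :
    F τ = c * E hk τ := by
  obtain ⟨f, rfl⟩ := exists_modularForm_levelOne hF hinv hlim
  obtain ⟨a, rfl⟩ := (finrank_eq_one_iff_of_nonzero' _ (E_ne_zero hk hk2)).mp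
    (Module.rank_eq_one_iff_finrank_eq_one.mp hrank) f
  have h1 : Tendsto (⇑(a • E hk)) atImInfty (𝓝 (a * 1)) :=
    (tendsto_E_atImInfty hk hk2).const_mul a
  rw [tendsto_nhds_unique hlim h1, mul_one]
  rfl

end LevelOneLimits

section Ramanujan

open UpperHalfPlane ModularForm EisensteinSeries Derivative Filter
open scoped Manifold

lemma normalizedDeriv_D2 (γ : SL(2, ℤ)) (τ : ℍ) :
    D (D2 γ) τ = -(γ 1 0 / denom γ τ : ℂ) ^ 2 := by
  have hd := denom_ne_zero γ τ
  have h := (hasDerivAt_denom_zpow (γ : GL (Fin 2) ℝ) (-1) τ).const_mul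
    (2 * Real.pi * Complex.I * (γ 1 0 : ℂ))
  have heq : (D2 γ ∘ ofComplex) =ᶠ[𝓝 (τ : ℂ)]
      fun w ↦ 2 * Real.pi * Complex.I * (γ 1 0 : ℂ) * denom γ w ^ (-1 : ℤ) := by
    filter_upwards [isOpen_upperHalfPlaneSet.mem_nhds τ.im_pos] with w hw
    simp [D2, ofComplex_apply_of_im_pos hw, div_eq_mul_inv]
  rw [normalizedDerivOfComplex, (h.congr_of_eventuallyEq heq).deriv]
  have hpi : (2 * Real.pi * Complex.I : ℂ) ≠ 0 := Complex.two_pi_I_ne_zero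
  have h10 : (((γ : GL (Fin 2) ℝ) 1 0 : ℝ) : ℂ) = (γ 1 0 : ℤ) := by simp
  rw [h10, show (-1 - 1 : ℤ) = -2 by norm_num, zpow_neg, zpow_ofNat]
  push_cast
  field_simp

lemma mdifferentiable_D2 (γ : SL(2, ℤ)) : MDiff (D2 γ) := by
  rw [UpperHalfPlane.mdifferentiable_iff]
  intro w hw
  have h := (hasDerivAt_denom_zpow (γ : GL (Fin 2) ℝ) (-1) ⟨w, hw⟩).const_mul
    (2 * Real.pi * Complex.I * (γ 1 0 : ℂ))
  refine (h.differentiableAt.congr_of_eventuallyEq ?_).differentiableWithinAt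
  filter_upwards [isOpen_upperHalfPlaneSet.mem_nhds hw] with v hv
  simp [D2, ofComplex_apply_of_im_pos hv, div_eq_mul_inv]

lemma slash_normalizedDeriv_E2 (γ : SL(2, ℤ)) :
    (fun τ ↦ E2 τ ^ 2 - 12 * D E2 τ) ∣[(4 : ℤ)] γ = fun τ ↦ E2 τ ^ 2 - 12 * D E2 τ := by
  ext τ
  have hd := denom_ne_zero γ τ
  have h1 := congrFun (normalizedDerivOfComplex_SL_slash (k := 2) (γ := γ) E2_mdifferentiable) τ
  have h2 := E2_slash_action γ
  have h3 : D (E2 ∣[(2 : ℤ)] γ) τ = D E2 τ + 1 / (2 * riemannZeta 2) * (γ 1 0 / denom γ τ) ^ 2 := by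
    rw [h2, normalizedDerivOfComplex_sub _ _ E2_mdifferentiable ((mdifferentiable_D2 γ).const_smul _),
      normalizedDerivOfComplex_smul _ _ (mdifferentiable_D2 γ)]
    simp [normalizedDeriv_D2]
  have h4 : (E2 ∣[(2 : ℤ)] γ) τ =
      E2 τ - 1 / (2 * riemannZeta 2) * (2 * Real.pi * Complex.I * (γ 1 0 / denom γ τ)) := by
    rw [h2]
    simp [D2, mul_div_assoc]
  have h5 : ((fun τ ↦ E2 τ ^ 2 - 12 * D E2 τ) ∣[(4 : ℤ)] γ) τ =
      ((E2 ∣[(2 : ℤ)] γ) τ) ^ 2 - 12 * (D E2 ∣[(4 : ℤ)] γ) τ := by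
    simp only [ModularForm.SL_slash_apply]
    rw [mul_pow, ← zpow_natCast (_ ^ (-2 : ℤ)), ← zpow_mul]
    norm_num
    ring
  rw [h5]
  have hpi : (Real.pi : ℂ) ≠ 0 := by exact_mod_cast Real.pi_ne_zero
  simp only [Pi.sub_apply, h3, h4, riemannZeta_two] at h1
  rw [show (2 + 2 : ℤ) = 4 by norm_num] at h1
  rw [h4, riemannZeta_two]
  generalize (γ 1 0 / denom γ τ : ℂ) = s at *
  have e1 : 1 / (2 * ((Real.pi : ℂ) ^ 2 / 6)) * (2 * Real.pi * Complex.I * s) =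
      6 * (Real.pi : ℂ)⁻¹ * Complex.I * s := by
    field
  have e2 : 1 / (2 * ((Real.pi : ℂ) ^ 2 / 6)) = 3 * (Real.pi : ℂ)⁻¹ ^ 2 := by
    field
  have e3 : (2 * Real.pi * Complex.I : ℂ)⁻¹ = -Complex.I * (Real.pi : ℂ)⁻¹ / 2 := by
    rw [mul_inv, mul_inv, Complex.inv_I]
    ring
  rw [e1, e2, e3] at h1
  rw [e1]
  push_cast at h1
  linear_combination 12 * h1 - 36 * (Real.pi : ℂ)⁻¹ ^ 2 * s ^ 2 * Complex.I_sq

/-- Ramanujan's identity for the derivative of `E₂`. -/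
theorem normalizedDeriv_E2 (τ : ℍ) : E2 τ ^ 2 - 12 * D E2 τ = E₄ τ := by
  have hD := tendsto_normalizedDerivOfComplex_atImInfty E2_mdifferentiable isBoundedAtImInfty_E2
  have := eq_smul_E_of_rank_one (k := 4) (by norm_num) ⟨2, rfl⟩ levelOne_weight_four_rank_one
    (F := fun τ ↦ E2 τ ^ 2 - 12 * D E2 τ) (c := 1) ?_ slash_normalizedDeriv_E2 ?_ τ
  · simpa using this
  · exact (E2_mdifferentiable.pow 2).sub
      (mdifferentiable_const.mul (normalizedDerivOfComplex_mdifferentiable E2_mdifferentiable))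
  · simpa using (tendsto_E2_atImInfty.pow 2).sub (hD.const_mul 12)

/-- Ramanujan's identity for the derivative of `E₄`. -/
theorem normalizedDeriv_E₄ (τ : ℍ) : D E₄ τ = (E2 τ * E₄ τ - E₆ τ) / 3 := by
  have hE : MDiff (E₄ : ℍ → ℂ) := E₄.holo'
  have hlim := tendsto_E_atImInfty (k := 4) (by norm_num) ⟨2, rfl⟩
  have hD := tendsto_normalizedDerivOfComplex_atImInfty hE (hlim.isBigO_one ℝ)
  have := eq_smul_E_of_rank_one (k := 6) (by norm_num) ⟨3, rfl⟩ levelOne_weight_six_rank_one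
    (F := serreDerivative 4 E₄) (c := -(1 / 3)) (serreDerivative_mdifferentiable 4 hE)
    (fun γ ↦ ?_) ?_ τ
  · rw [serreDerivative_apply] at this
    linear_combination this
  · exact_mod_cast serreDerivative_slash_invariant (k := 4) hE
      (SlashInvariantForm.slash_action_eqn E₄ γ ⟨γ, rfl⟩)
  · have h := hD.sub ((tendsto_E2_atImInfty.const_mul (4 * 12⁻¹)).mul hlim)
    convert! h using 2
    norm_num

end Ramanujan

section ZerosOfE₄

open UpperHalfPlane ModularForm EisensteinSeries Filter

lemma E_smul {k : ℕ} (hk : 3 ≤ k) (γ : SL(2, ℤ)) (τ : ℍ) :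
    E hk (γ • τ) = denom γ τ ^ k * E hk τ := by
  have h := congrFun (SlashInvariantForm.slash_action_eqn (E hk) γ ⟨γ, rfl⟩) τ
  have hd := denom_ne_zero γ τ
  rw [← ModularForm.SL_slash, ModularForm.SL_slash_apply] at h
  rw [← h]
  simp only [zpow_neg, zpow_natCast]
  field_simp

lemma E_smul_eq_zero_iff {k : ℕ} (hk : 3 ≤ k) (γ : SL(2, ℤ)) (τ : ℍ) :
    E hk (γ • τ) = 0 ↔ E hk τ = 0 := by
  rw [E_smul, mul_eq_zero, or_iff_right (pow_ne_zero _ (denom_ne_zero γ τ))]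

lemma coe_rhoPoint_sq : (rhoPoint : ℂ) ^ 2 = rhoPoint - 1 := by
  have h3 : (Real.sqrt 3) ^ 2 = 3 := Real.sq_sqrt (by norm_num)
  apply Complex.ext <;> simp [rhoPoint, pow_two] <;> nlinarith

lemma T_S_smul_rhoPoint : ModularGroup.T • ModularGroup.S • rhoPoint = rhoPoint := by
  ext
  have h0 := rhoPoint.ne_zero
  rw [modular_T_smul, modular_S_smul]
  change (((1 : ℝ) : ℂ) + (-(rhoPoint : ℂ))⁻¹) = rhoPoint
  push_cast
  field_simp
  linear_combination -coe_rhoPoint_sq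

lemma E₄_rhoPoint : E₄ rhoPoint = 0 := by
  have h0 := rhoPoint.ne_zero
  have h := E_smul (k := 4) (by norm_num) (ModularGroup.T * ModularGroup.S) rhoPoint
  rw [mul_smul, T_S_smul_rhoPoint] at h
  have hd : denom (ModularGroup.T * ModularGroup.S : SL(2, ℤ)) rhoPoint = rhoPoint := by
    rw [ModularGroup.denom_apply]
    simp [ModularGroup.coe_S]
  rw [hd] at h
  have h4 : (rhoPoint : ℂ) ^ 4 = -rhoPoint := by
    linear_combination ((rhoPoint : ℂ) ^ 2 + rhoPoint) * coe_rhoPoint_sq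
  rw [h4] at h
  have h5 : (1 + rhoPoint : ℂ) * E₄ rhoPoint = 0 := by linear_combination h
  refine (mul_eq_zero.mp h5).resolve_left fun h6 ↦ ?_
  have := congrArg Complex.im h6
  simp [rhoPoint.im_pos.ne'] at this

lemma norm_pow_sub_pow_le {a b : ℂ} {r : ℝ} (ha : ‖a‖ ≤ r) (hb : ‖b‖ ≤ r) (n : ℕ) :
    ‖a ^ n - b ^ n‖ ≤ n * r ^ (n - 1) * ‖a - b‖ := by
  have h := Convex.norm_image_sub_le_of_norm_deriv_le (f := fun z : ℂ ↦ z ^ n) (𝕜 := ℂ)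
    (s := Metric.closedBall 0 r) (C := n * r ^ (n - 1)) (x := b) (y := a)
    (fun z _ ↦ by fun_prop) (fun z hz ↦ ?_) (convex_closedBall _ _) (by simpa using hb)
    (by simpa using ha)
  · exact h
  · rw [deriv_pow_field, norm_mul, norm_pow, Complex.norm_natCast]
    gcongr
    simpa using hz

lemma pow_five_le (n : ℕ) : (n + 1) ^ 5 ≤ 32 ^ n := by
  induction n with
  | zero => simp
  | succ n ih =>
    calc (n + 1 + 1) ^ 5 ≤ (2 * (n + 1)) ^ 5 := by gcongr; omega
      _ = 32 * (n + 1) ^ 5 := by ring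
      _ ≤ 32 * 32 ^ n := by gcongr
      _ = 32 ^ (n + 1) := by ring

/-- The function `∑ σ₃(n) qⁿ` is injective on a small disc. -/
lemma eq_of_hasSum_sigma_three {a b s : ℂ} (ha : ‖a‖ ≤ 1 / 100) (hb : ‖b‖ ≤ 1 / 100)
    (hsa : HasSum (fun n : ℕ ↦ (ArithmeticFunction.sigma 3 (n + 1) : ℂ) * a ^ (n + 1)) s)
    (hsb : HasSum (fun n : ℕ ↦ (ArithmeticFunction.sigma 3 (n + 1) : ℂ) * b ^ (n + 1)) s) :
    a = b := by
  have h := hsa.sub hsb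
  rw [sub_self, ← hasSum_nat_add_iff' 1] at h
  simp only [Finset.sum_range_one, zero_add, ArithmeticFunction.sigma_one, Nat.cast_one, pow_one,
    one_mul, zero_sub] at h
  have hg : HasSum (fun n : ℕ ↦ (8 / 25 : ℝ) * ‖a - b‖ * (8 / 25) ^ n)
      ((8 / 25 : ℝ) * ‖a - b‖ * (1 - 8 / 25)⁻¹) :=
    (hasSum_geometric_of_lt_one (by norm_num) (by norm_num)).mul_left _
  have hle : ‖-(a - b)‖ ≤ (8 / 25 : ℝ) * ‖a - b‖ * (1 - 8 / 25)⁻¹ := by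
    rw [← h.tsum_eq]
    refine tsum_of_norm_bounded hg fun n ↦ ?_
    rw [← mul_sub, norm_mul, Complex.norm_natCast]
    have h1 : (ArithmeticFunction.sigma 3 (n + 1 + 1) : ℝ) ≤ (n + 2) ^ 4 := by
      exact_mod_cast ArithmeticFunction.sigma_le_pow_succ 3 (n + 2)
    have h2 := norm_pow_sub_pow_le ha hb (n + 2)
    have h3 : ((n : ℝ) + 2) ^ 5 ≤ 32 ^ (n + 1) := by exact_mod_cast pow_five_le (n + 1)
    calc (ArithmeticFunction.sigma 3 (n + 1 + 1) : ℝ) * ‖a ^ (n + 1 + 1) - b ^ (n + 1 + 1)‖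
        ≤ (n + 2) ^ 4 * ((n + 2) * (1 / 100) ^ (n + 1) * ‖a - b‖) := by
          gcongr
          simpa using h2
      _ = (n + 2) ^ 5 * (1 / 100) ^ (n + 1) * ‖a - b‖ := by ring
      _ ≤ 32 ^ (n + 1) * (1 / 100) ^ (n + 1) * ‖a - b‖ := by gcongr
      _ = 8 / 25 * ‖a - b‖ * (8 / 25) ^ n := by
          rw [← mul_pow, pow_succ]
          norm_num
          ring
  rw [norm_neg] at hle
  have : ‖a - b‖ = 0 := by nlinarith [norm_nonneg (a - b)]
  exact sub_eq_zero.mp (norm_eq_zero.mp this)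

lemma norm_exp_two_pi_I_le {τ : ℍ} (h : 3 ≤ 4 * τ.im ^ 2) :
    ‖Complex.exp (2 * Real.pi * Complex.I * τ)‖ ≤ 1 / 100 := by
  have him : 17 / 20 ≤ τ.im := by nlinarith [τ.im_pos]
  have hre : (2 * Real.pi * Complex.I * τ : ℂ).re = -(2 * Real.pi * τ.im) := by simp
  rw [Complex.norm_exp, hre, Real.exp_neg, ← one_div]
  apply one_div_le_one_div_of_le (by norm_num)
  calc (100 : ℝ) ≤ 2.7 ^ 5 := by norm_num
    _ ≤ Real.exp 1 ^ 5 := by gcongr; linarith [Real.exp_one_gt_d9]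
    _ = Real.exp 5 := by rw [← Real.exp_nat_mul]; norm_num
    _ ≤ _ := Real.exp_le_exp.mpr (by nlinarith [Real.pi_gt_three])

lemma hasSum_sigma_three_of_E₄_eq_zero {τ : ℍ} (h : E₄ τ = 0) :
    HasSum (fun n : ℕ ↦ (ArithmeticFunction.sigma 3 (n + 1) : ℂ) *
      Complex.exp (2 * Real.pi * Complex.I * τ) ^ (n + 1)) (-(1 / 240)) := by
  have hs := hasSum_qParam_levelOne E₄ τ
  rw [h, ← hasSum_nat_add_iff' 1] at hs
  have hs' := hs.mul_left (1 / 240 : ℂ)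
  convert! hs' using 1
  · ext n
    rw [E_qExpansion_coeff _ ⟨2, rfl⟩]
    norm_num [show bernoulli 4 = -1 / 30 by decide +kernel, Function.Periodic.qParam]
    ring
  · simp [E_qExpansion_coeff_zero _ (⟨2, rfl⟩ : Even 4), -PowerSeries.coeff_zero_eq_constantCoeff]

lemma exists_T_zpow_smul_eq_of_E₄_eq_zero {τ σ : ℍ} (hτ : 3 ≤ 4 * τ.im ^ 2) (hσ : 3 ≤ 4 * σ.im ^ 2)
    (h : E₄ τ = 0) (h' : E₄ σ = 0) : ∃ n : ℤ, τ = ModularGroup.T ^ n • σ := by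
  have he := eq_of_hasSum_sigma_three (norm_exp_two_pi_I_le hτ) (norm_exp_two_pi_I_le hσ)
    (hasSum_sigma_three_of_E₄_eq_zero h) (hasSum_sigma_three_of_E₄_eq_zero h')
  obtain ⟨n, hn⟩ := Complex.exp_eq_exp_iff_exists_int.mp he
  refine ⟨n, ?_⟩
  ext
  rw [ModularGroup.coe_T_zpow_smul_eq]
  apply mul_left_cancel₀ Complex.two_pi_I_ne_zero
  linear_combination hn

/-- The zeros of `E₄` are the points equivalent to `ρ`. -/
theorem E₄_eq_zero_iff (τ : ℍ) : E₄ τ = 0 ↔ τ ∈ MulAction.orbit SL(2, ℤ) rhoPoint := by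
  constructor
  · intro h
    obtain ⟨γ, hγ⟩ := ModularGroup.exists_smul_mem_fd τ
    have hρ : 3 ≤ 4 * rhoPoint.im ^ 2 := by
      have h3 : (Real.sqrt 3) ^ 2 = 3 := Real.sq_sqrt (by norm_num)
      change 3 ≤ 4 * (Real.sqrt 3 / 2) ^ 2
      linarith
    obtain ⟨n, hn⟩ := exists_T_zpow_smul_eq_of_E₄_eq_zero
      (ModularGroup.three_le_four_mul_im_sq_of_mem_fd hγ) hρ
      ((E_smul_eq_zero_iff _ γ τ).mpr h) E₄_rhoPoint
    exact ⟨γ⁻¹ * ModularGroup.T ^ n, by simp only [mul_smul, ← hn, inv_smul_smul]⟩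
  · rintro ⟨γ, rfl⟩
    exact (E_smul_eq_zero_iff _ γ rhoPoint).mpr E₄_rhoPoint

end ZerosOfE₄

section CriticalPoints

open UpperHalfPlane ModularForm EisensteinSeries Derivative Filter
open scoped Manifold

lemma analyticAt_comp_ofComplex {F : ℍ → ℂ} (hF : MDiff F) (τ : ℍ) :
    AnalyticAt ℂ (F ∘ ofComplex) τ :=
  (UpperHalfPlane.mdifferentiable_iff.mp hF).analyticAt
    (isOpen_upperHalfPlaneSet.mem_nhds τ.im_pos)

lemma G2_eq_mul_E2 : G2 = ((Real.pi : ℂ) ^ 2 / 3) • E2 := by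
  rw [E2, smul_smul, riemannZeta_two]
  have hpi : (Real.pi : ℂ) ≠ 0 := by exact_mod_cast Real.pi_ne_zero
  rw [show (Real.pi : ℂ) ^ 2 / 3 * (1 / (2 * (Real.pi ^ 2 / 6))) = 1 by field, one_smul]

lemma mdifferentiable_G2 : MDiff G2 := by
  rw [G2_eq_mul_E2]
  exact E2_mdifferentiable.const_smul _

lemma G2_sq_add_deriv (τ : ℍ) :
    G2 τ ^ 2 + 2 * Real.pi * Complex.I * deriv (G2 ∘ ofComplex) τ = Real.pi ^ 4 / 9 * E₄ τ := by
  have hD : deriv (G2 ∘ ofComplex) τ = 2 * Real.pi * Complex.I * D G2 τ := by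
    rw [normalizedDerivOfComplex, mul_inv_cancel_left₀ Complex.two_pi_I_ne_zero]
  rw [hD, G2_eq_mul_E2, normalizedDerivOfComplex_smul _ _ E2_mdifferentiable, ← normalizedDeriv_E2]
  simp only [Pi.smul_apply, smul_eq_mul]
  linear_combination 4 * Real.pi ^ 4 / 3 * D E2 τ * Complex.I_sq

lemma hasDerivAt_sub_div_G2 {τ : ℍ} (h : G2 τ ≠ 0) :
    HasDerivAt (fun z ↦ z - 2 * Real.pi * Complex.I / (G2 ∘ ofComplex) z)
      (Real.pi ^ 4 / 9 / G2 τ ^ 2 * E₄ τ) τ := by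
  have h0 : (G2 ∘ ofComplex) τ = G2 τ := by simp
  have hd := (analyticAt_comp_ofComplex mdifferentiable_G2 τ).differentiableAt.hasDerivAt
  convert! (hasDerivAt_id (τ : ℂ)).sub
    ((hasDerivAt_const (τ : ℂ) (2 * Real.pi * Complex.I : ℂ)).div hd (by rwa [h0])) using 1
  rw [h0, div_mul_eq_mul_div, ← G2_sq_add_deriv]
  field_simp
  ring

lemma hasDerivAt_G2_div {τ : ℍ} (h : τ * G2 τ - 2 * Real.pi * Complex.I ≠ 0) :
    HasDerivAt (fun z ↦ (G2 ∘ ofComplex) z / (z * (G2 ∘ ofComplex) z - 2 * Real.pi * Complex.I))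
      (-(Real.pi ^ 4 / 9) / (τ * G2 τ - 2 * Real.pi * Complex.I) ^ 2 * E₄ τ) τ := by
  have h0 : (G2 ∘ ofComplex) τ = G2 τ := by simp
  have hd := (analyticAt_comp_ofComplex mdifferentiable_G2 τ).differentiableAt.hasDerivAt
  convert! hd.div (((hasDerivAt_id (τ : ℂ)).mul hd).sub_const (2 * Real.pi * Complex.I : ℂ))
    (by simpa [h0] using h) using 1
  rw [h0, id, neg_div, neg_mul, div_mul_eq_mul_div, ← G2_sq_add_deriv]
  simp only [Pi.mul_apply, h0, id]
  rw [← neg_div]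
  congr 1
  ring

lemma eventually_mem_upperHalfPlane (τ : ℍ) : ∀ᶠ z : ℂ in 𝓝 (τ : ℂ), ∃ σ : ℍ, z = (σ : ℂ) := by
  filter_upwards [isOpen_upperHalfPlaneSet.mem_nhds τ.im_pos] with z hz
  exact ⟨⟨z, hz⟩, rfl⟩

/-- In the coordinate at `p τ`, the function `p` is holomorphic and its derivative is `E₄` up to a
holomorphic factor without zeros. -/
lemma exists_deriv_localRep_quasiPeriodMap (τ : ℍ) :
    AnalyticAt ℂ (RiemannSphere.localRep quasiPeriodMap τ) τ ∧
    ∃ u : ℂ → ℂ, AnalyticAt ℂ u τ ∧ u τ ≠ 0 ∧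
      deriv (RiemannSphere.localRep quasiPeriodMap τ) =ᶠ[𝓝 (τ : ℂ)]
        u * ((E₄ : ℍ → ℂ) ∘ ofComplex) := by
  have hg := analyticAt_comp_ofComplex mdifferentiable_G2 τ
  have h0 (σ : ℍ) : (G2 ∘ ofComplex) σ = G2 σ := by simp
  have hpi : (Real.pi : ℂ) ≠ 0 := by exact_mod_cast Real.pi_ne_zero
  by_cases h : G2 τ = 0
  · set d : ℂ → ℂ := fun z ↦ z * (G2 ∘ ofComplex) z - 2 * Real.pi * Complex.I with hd
    have hdan : AnalyticAt ℂ d τ := (analyticAt_id.mul hg).sub analyticAt_const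
    have hdτ : d τ ≠ 0 := by
      simp only [hd, h0, h, mul_zero, zero_sub]
      exact neg_ne_zero.mpr Complex.two_pi_I_ne_zero
    have hloc : RiemannSphere.localRep quasiPeriodMap τ =ᶠ[𝓝 (τ : ℂ)]
        fun z ↦ (G2 ∘ ofComplex) z / d z := by
      filter_upwards [eventually_mem_upperHalfPlane τ] with z hz
      obtain ⟨σ, rfl⟩ := hz
      rw [RiemannSphere.localRep, RiemannSphere.coordAt, if_pos (quasiPeriodMap_eq_infty h),
        ofComplex_apply]
      simp only [hd, h0]
      by_cases hσ : G2 σ = 0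
      · rw [quasiPeriodMap_eq_infty hσ, hσ, zero_div]
        rfl
      · rw [quasiPeriodMap_eq_coe hσ]
        change (σ - 2 * Real.pi * Complex.I / G2 σ : ℂ)⁻¹ = _
        rw [sub_div' hσ, inv_div]
    refine ⟨(hg.div hdan hdτ).congr hloc.symm, fun z ↦ -(Real.pi ^ 4 / 9) / d z ^ 2,
      analyticAt_const.div (hdan.pow 2) (pow_ne_zero 2 hdτ), ?_, ?_⟩
    · exact div_ne_zero (by simp) (pow_ne_zero 2 hdτ)
    · refine hloc.deriv.trans ?_
      filter_upwards [eventually_mem_upperHalfPlane τ, hdan.continuousAt.eventually_ne hdτ]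
        with z hz hdz
      obtain ⟨σ, rfl⟩ := hz
      simp only [hd, h0] at hdz
      rw [(hasDerivAt_G2_div hdz).deriv]
      simp [hd]
  · have hgτ : (G2 ∘ ofComplex) τ ≠ 0 := by rwa [h0]
    have hne := hg.continuousAt.eventually_ne hgτ
    have hloc : RiemannSphere.localRep quasiPeriodMap τ =ᶠ[𝓝 (τ : ℂ)]
        fun z ↦ z - 2 * Real.pi * Complex.I / (G2 ∘ ofComplex) z := by
      filter_upwards [eventually_mem_upperHalfPlane τ, hne] with z hz hgz
      obtain ⟨σ, rfl⟩ := hz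
      rw [h0] at hgz ⊢
      rw [RiemannSphere.localRep, RiemannSphere.coordAt,
        if_neg (by rw [quasiPeriodMap_eq_coe h]; exact OnePoint.coe_ne_infty _),
        ofComplex_apply, quasiPeriodMap_eq_coe hgz]
      rfl
    refine ⟨(analyticAt_id.sub (analyticAt_const.div hg hgτ)).congr hloc.symm,
      fun z ↦ Real.pi ^ 4 / 9 / (G2 ∘ ofComplex) z ^ 2,
      analyticAt_const.div (hg.pow 2) (pow_ne_zero 2 hgτ), ?_, ?_⟩
    · exact div_ne_zero (by simp) (pow_ne_zero 2 hgτ)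
    · refine hloc.deriv.trans ?_
      filter_upwards [eventually_mem_upperHalfPlane τ, hne] with z hz hgz
      obtain ⟨σ, rfl⟩ := hz
      rw [h0] at hgz
      rw [(hasDerivAt_sub_div_G2 hgz).deriv]
      simp

lemma continuousAt_inv_onePoint :
    ContinuousAt (fun w : ℂ ↦ if w = 0 then OnePoint.infty else ((w⁻¹ : ℂ) : OnePoint ℂ)) 0 := by
  rw [continuousAt_iff_punctured_nhds, if_pos rfl]
  have h : Tendsto (fun w : ℂ ↦ ((w⁻¹ : ℂ) : OnePoint ℂ)) (𝓝[≠] 0) (𝓝 OnePoint.infty) := by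
    have h1 : Tendsto (fun w : ℂ ↦ w⁻¹) (𝓝[≠] 0) (coclosedCompact ℂ) := by
      rw [coclosedCompact_eq_cocompact, ← Metric.cobounded_eq_cocompact]
      exact tendsto_inv₀_nhdsNE_zero
    exact OnePoint.tendsto_coe_infty.comp h1
  refine h.congr' ?_
  filter_upwards [self_mem_nhdsWithin] with w hw
  exact (if_neg hw).symm

lemma continuousAt_quasiPeriodMap (τ : ℍ) : ContinuousAt quasiPeriodMap τ := by
  have hcont : Continuous G2 := mdifferentiable_G2.continuous
  by_cases h : G2 τ = 0
  · set φ : ℍ → ℂ := fun σ ↦ G2 σ / (σ * G2 σ - 2 * Real.pi * Complex.I) with hφ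
    have hd : (τ * G2 τ - 2 * Real.pi * Complex.I : ℂ) ≠ 0 := by
      rw [h, mul_zero, zero_sub]
      exact neg_ne_zero.mpr Complex.two_pi_I_ne_zero
    have hdc : ContinuousAt (fun σ : ℍ ↦ (σ * G2 σ - 2 * Real.pi * Complex.I : ℂ)) τ :=
      ((continuous_coe.mul hcont).sub continuous_const).continuousAt
    have hφc : ContinuousAt φ τ := hcont.continuousAt.div hdc hd
    have hφ0 : φ τ = 0 := by simp [hφ, h]
    have hc := continuousAt_inv_onePoint.comp_of_eq hφc hφ0
    refine hc.congr ?_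
    filter_upwards [hdc.eventually_ne hd] with σ hσ
    by_cases hσ0 : G2 σ = 0
    · simp [hφ, hσ0, quasiPeriodMap_eq_infty]
    · rw [Function.comp_apply, if_neg (div_ne_zero hσ0 hσ), quasiPeriodMap_eq_coe hσ0, inv_div,
        sub_div' hσ0]
  · have hc : ContinuousAt (fun σ : ℍ ↦
        ((σ - 2 * Real.pi * Complex.I / G2 σ : ℂ) : OnePoint ℂ)) τ :=
      OnePoint.continuous_coe.continuousAt.comp
        (continuous_coe.continuousAt.sub (continuousAt_const.div hcont.continuousAt h))
    refine hc.congr ?_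
    filter_upwards [hcont.continuousAt.eventually_ne h] with σ hσ
    rw [quasiPeriodMap_eq_coe hσ]

/-- The zeros of `E₄` are simple. -/
lemma analyticOrderAt_E₄ {τ : ℍ} (h : E₄ τ = 0) :
    analyticOrderAt ((E₄ : ℍ → ℂ) ∘ ofComplex) τ = 1 := by
  refine (analyticAt_comp_ofComplex (F := E₄) E₄.holo' τ).analyticOrderAt_eq_one_of_zero_deriv_ne_zero
    (by simpa using h) fun hd ↦ discriminant_ne_zero τ ?_
  have hD := normalizedDeriv_E₄ τ
  rw [normalizedDerivOfComplex, hd, h, mul_zero, mul_zero, zero_sub, eq_comm, div_eq_zero_iff,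
    or_iff_left (by norm_num), neg_eq_zero] at hD
  rw [discriminant_eq_E₄_cube_sub_E₆_sq, h, hD]
  norm_num

lemma isCriticalPoint_quasiPeriodMap_iff (τ : ℍ) :
    RiemannSphere.IsCriticalPoint quasiPeriodMap τ ↔ E₄ τ = 0 := by
  obtain ⟨han, u, -, hu0, hu⟩ := exists_deriv_localRep_quasiPeriodMap τ
  rw [RiemannSphere.IsCriticalPoint, hu.eq_of_nhds]
  simp [RiemannSphere.HolomorphicAt, han, continuousAt_quasiPeriodMap τ, hu0]

end CriticalPoints

theorem corollary14 :
    (∀ τ : ℍ, RiemannSphere.HolomorphicAt quasiPeriodMap τ) ∧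
    (∀ τ : ℍ, RiemannSphere.IsCriticalPoint quasiPeriodMap τ ↔
      τ ∈ MulAction.orbit SL(2, ℤ) rhoPoint) ∧
    (∀ τ : ℍ, RiemannSphere.IsCriticalPoint quasiPeriodMap τ →
      RiemannSphere.localDegree quasiPeriodMap τ = 2) := by
  refine ⟨fun τ ↦ ⟨continuousAt_quasiPeriodMap τ, (exists_deriv_localRep_quasiPeriodMap τ).1⟩,
    fun τ ↦ (isCriticalPoint_quasiPeriodMap_iff τ).trans (E₄_eq_zero_iff τ), fun τ hτ ↦ ?_⟩
  obtain ⟨han, u, hua, hu0, hu⟩ := exists_deriv_localRep_quasiPeriodMap τ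
  rw [RiemannSphere.localDegree, ← han.analyticOrderAt_deriv_add_one, analyticOrderAt_congr hu,
    analyticOrderAt_mul hua (analyticAt_comp_ofComplex (F := ModularForm.E₄) ModularForm.E₄.holo' τ),
    hua.analyticOrderAt_eq_zero.mpr hu0,
    analyticOrderAt_E₄ ((isCriticalPoint_quasiPeriodMap_iff τ).mp hτ)]
  norm_num
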